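/- Let $d\in\mathbb N$ and let $\mathcal S_d$ be the set of density matrices, i.e. positive semidefinite matrices $\rho\in\mathcal M_d=\mathbb C^{d\times d}$ with $\operatorname{tr}\rho=1$. For $\alpha\in[0,1]$ and $\rho,\sigma\in\mathcal S_d$ put $$\chi^2_\alpha(\rho,\sigma)=\operatorname{tr}\bigl[(\rho-\sigma)\,\sigma^{-\alpha}(\rho-\sigma)\,\sigma^{\alpha-1}\bigr]$$ if $\operatorname{supp}\rho\subseteq\operatorname{supp}\sigma$ (powers of $\sigma$ being taken on its support), and $\chi^2_\alpha(\rho,\sigma)=+\infty$ otherwise. Here the support of a Hermitian matrix is its range. Then for every $\alpha\in[0,1]$: 1. $\chi^2_\alpha$ is jointly convex: for all $\rho_1,\rho_2,\sigma_1,\sigma_2\in\mathcal S_d$ and all $a,b\ge 0$ with $a+b=1$, $$\chi^2_\alpha(a\rho_1+b\rho_2,\;a\sigma_1+b\sigma_2)\le a\,\chi^2_\alpha(\rho_1,\sigma_1)+b\,\chi^2_\alpha(\rho_2,\sigma_2)$$ (with $0\cdot\infty=0$). 2. $\chi^2_\alpha$ is monotone under quantum channels: for every completely positive trace-preserving linear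 map $T:\mathcal M_d\to\mathcal M_d$ and all $\rho,\sigma\in\mathcal S_d$, $$\chi^2_\alpha\bigl(T(\rho),T(\sigma)\bigr)\le\chi^2_\alpha(\rho,\sigma).$$ -/

import Mathlib

open scoped ComplexOrder in
/-- The density matrices: positive semidefinite complex `d × d` matrices of trace one. -/
def densityMatrices (d : ℕ) : Set (Matrix (Fin d) (Fin d) ℂ) :=
  {ρ | ρ.PosSemidef ∧ ρ.trace = 1}

/-- The support of a Hermitian matrix: the span of the eigenvectors with nonzero eigenvalue,
which is the range of the matrix as an operator on `ℂ^d`. -/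
def matrixSupport {d : ℕ} (A : Matrix (Fin d) (Fin d) ℂ) : Submodule ℂ (Fin d → ℂ) :=
  LinearMap.range A.mulVecLin

open scoped MatrixOrder in
/-- The trace `tr[(ρ - σ) σ^{-α} (ρ - σ) σ^{α-1}]`. For positive semidefinite `σ` the real power
`CFC.rpow σ s` applies `x ↦ x ^ s` to the eigenvalues; as `0 ^ s = 0` for `s ≠ 0`, negative powers
are taken on the support of `σ` and vanish on its kernel. (The power `s = 0` gives the identity
instead of the support projection; this makes no difference to the trace when
`supp ρ ⊆ supp σ`.) -/
noncomputable def chiSqTrace {d : ℕ} (α : ℝ) (ρ σ : Matrix (Fin d) (Fin d) ℂ) : ℂ :=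
  ((ρ - σ) * CFC.rpow σ (-α) * (ρ - σ) * CFC.rpow σ (α - 1)).trace

open scoped MatrixOrder in
/-- The trace is a real number, so that nothing is lost by taking its real part below. -/
theorem chiSqTrace_im {d : ℕ} (α : ℝ) {ρ σ : Matrix (Fin d) (Fin d) ℂ}
    (hρ : ρ.IsHermitian) (hσ : σ.IsHermitian) : (chiSqTrace α ρ σ).im = 0 := by
  have h (s : ℝ) : (CFC.rpow σ s).conjTranspose = CFC.rpow σ s :=
    (IsSelfAdjoint.of_nonneg (CFC.rpow_nonneg (a := σ) (y := s))).star_eq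
  have hd : (ρ - σ).conjTranspose = ρ - σ := hρ.sub hσ
  rw [← Complex.conj_eq_iff_im, ← RCLike.star_def, chiSqTrace, ← Matrix.trace_conjTranspose]
  simp only [Matrix.conjTranspose_mul, h, hd]
  rw [Matrix.trace_mul_comm]
  simp only [Matrix.mul_assoc]

open Classical in
/-- The divergence `χ²_α(ρ, σ)`: the trace above if `supp ρ ⊆ supp σ`, and `+∞` otherwise. -/
noncomputable def chiSq {d : ℕ} (α : ℝ) (ρ σ : Matrix (Fin d) (Fin d) ℂ) : EReal :=
  if matrixSupport ρ ≤ matrixSupport σ then (((chiSqTrace α ρ σ).re : ℝ) : EReal) else ⊤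

open scoped MatrixOrder Matrix.Norms.L2Operator CStarAlgebra in
/-- A linear map on `d × d` matrices is a quantum channel if it is completely positive and
trace preserving. -/
def IsQuantumChannel {d : ℕ}
    (T : Matrix (Fin d) (Fin d) ℂ →ₗ[ℂ] Matrix (Fin d) (Fin d) ℂ) : Prop :=
  (∃ Φ : Matrix (Fin d) (Fin d) ℂ →CP Matrix (Fin d) (Fin d) ℂ, ∀ A, Φ A = T A) ∧
    ∀ A, (T A).trace = A.trace

/-! With `X = ρ - σ`, in an eigenbasis of `σ` the divergence is a sum of `|X i j|²` weighted by `l ^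
(-α) * m ^ (α - 1)`, where `l`, `m` are eigenvalues. For `0 < α < 1` this weight is a positive
mixture of the kernels `1 / (l + t * m)`, so the divergence is a mixture of resolvent forms `⟨X,
(L_σ + t R_σ)⁻¹ X⟩`; for `α = 0, 1` it is a single such form.

Each form is the supremum over `Y` of `quadForm`, which is linear in `(X, σ)`; this gives joint
convexity (`quadForm_smul_add`). For a channel, the trace adjoint moves `T` onto `Y`, and a Schwarz
inequality controls the quadratic terms (`IsQuantumChannel.quadForm_le`). Both claims then follow
from `chiSq_le_of_quadForm_le`. -/

open Matrix MeasureTheory Set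

/-! ### Variational form of the resolvent. -/

section VariationalForm

variable {n : Type*} [Fintype n]

/-- The concave quadratic function of `Y` whose supremum is
`⟨X, (u L_σ + v R_σ)⁻¹ X⟩`, where `L_σ` and `R_σ` are left and right multiplication by `σ`. -/
noncomputable def quadForm (u v : ℝ) (X σ Y : Matrix n n ℂ) : ℝ :=
  2 * (Yᴴ * X).trace.re - u * (σ * Y * Yᴴ).trace.re - v * (σ * Yᴴ * Y).trace.re

theorem quadForm_smul_add (u v a b : ℝ) (X₁ X₂ σ₁ σ₂ Y : Matrix n n ℂ) :
    quadForm u v (a • X₁ + b • X₂) (a • σ₁ + b • σ₂) Y =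
      a * quadForm u v X₁ σ₁ Y + b * quadForm u v X₂ σ₂ Y := by
  simp only [quadForm, Matrix.mul_add, Matrix.add_mul, Matrix.mul_smul, Matrix.smul_mul,
    trace_add, trace_smul, Complex.add_re, Complex.real_smul, Complex.re_ofReal_mul]
  ring

variable [DecidableEq n]

theorem quadForm_conj {U : Matrix n n ℂ} (hU : Uᴴ * U = 1) (u v : ℝ) (X σ Y : Matrix n n ℂ) :
    quadForm u v (U * X * Uᴴ) (U * σ * Uᴴ) (U * Y * Uᴴ) = quadForm u v X σ Y := by
  have key (A B : Matrix n n ℂ) : (U * A * Uᴴ) * (U * B * Uᴴ) = U * (A * B) * Uᴴ := by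
    calc (U * A * Uᴴ) * (U * B * Uᴴ) = U * A * (Uᴴ * U) * B * Uᴴ := by
          simp only [Matrix.mul_assoc]
      _ = _ := by rw [hU]; simp only [Matrix.mul_assoc, Matrix.mul_one]
  have ht (A : Matrix n n ℂ) : (U * A * Uᴴ).trace = A.trace := by
    rw [trace_mul_comm, ← Matrix.mul_assoc, hU, Matrix.one_mul]
  have hs : (U * Y * Uᴴ)ᴴ = U * Yᴴ * Uᴴ := by
    simp [conjTranspose_mul, Matrix.mul_assoc]
  simp only [quadForm, hs, key, ht]

theorem quadForm_diagonal (u v : ℝ) (X Y : Matrix n n ℂ) (l : n → ℝ) :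
    quadForm u v X (diagonal fun i => (l i : ℂ)) Y =
      ∑ i, ∑ j, (2 * (star (Y i j) * X i j).re - (u * l i + v * l j) * Complex.normSq (Y i j)) := by
  have h1 : (Yᴴ * X).trace.re = ∑ i, ∑ j, (star (Y i j) * X i j).re := by
    simp only [trace, diag_apply, mul_apply, conjTranspose_apply, Complex.re_sum]
    exact Finset.sum_comm
  have h2 : ((diagonal fun i => (l i : ℂ)) * Y * Yᴴ).trace.re =
      ∑ i, ∑ j, l i * Complex.normSq (Y i j) := by
    simp only [trace, diag_apply, mul_apply (N := Yᴴ), conjTranspose_apply, diagonal_mul,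
      Complex.re_sum, mul_assoc, Complex.re_ofReal_mul]
    simp [Complex.normSq_apply, Finset.mul_sum]
  have h3 : ((diagonal fun i => (l i : ℂ)) * Yᴴ * Y).trace.re =
      ∑ i, ∑ j, l j * Complex.normSq (Y i j) := by
    rw [Finset.sum_comm]
    simp only [trace, diag_apply, mul_apply (N := Y), conjTranspose_apply, diagonal_mul,
      Complex.re_sum, mul_assoc, Complex.re_ofReal_mul]
    simp [Complex.normSq_apply, Finset.mul_sum]
  simp only [quadForm, h1, h2, h3, Finset.mul_sum, ← Finset.sum_sub_distrib]
  refine Finset.sum_congr rfl fun i _ => Finset.sum_congr rfl fun j _ => ?_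
  ring

/-- The matrix `X` in the eigenbasis of the Hermitian matrix `σ`. -/
noncomputable def eigenCoords {σ : Matrix n n ℂ} (hσ : σ.IsHermitian) (X : Matrix n n ℂ) :
    Matrix n n ℂ :=
  (hσ.eigenvectorUnitary : Matrix n n ℂ)ᴴ * X * (hσ.eigenvectorUnitary : Matrix n n ℂ)

section eigenCoords

variable {σ : Matrix n n ℂ} (hσ : σ.IsHermitian)

theorem eigenvectorUnitary_conjTranspose_mul :
    (hσ.eigenvectorUnitary : Matrix n n ℂ)ᴴ * (hσ.eigenvectorUnitary : Matrix n n ℂ) = 1 :=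
  Unitary.coe_star_mul_self _

theorem eigenvectorUnitary_mul_conjTranspose :
    (hσ.eigenvectorUnitary : Matrix n n ℂ) * (hσ.eigenvectorUnitary : Matrix n n ℂ)ᴴ = 1 :=
  Unitary.coe_mul_star_self _

theorem conj_eigenCoords (X : Matrix n n ℂ) :
    (hσ.eigenvectorUnitary : Matrix n n ℂ) * eigenCoords hσ X *
      (hσ.eigenvectorUnitary : Matrix n n ℂ)ᴴ = X := by
  have h := eigenvectorUnitary_mul_conjTranspose hσ
  calc _ = ((hσ.eigenvectorUnitary : Matrix n n ℂ) * (hσ.eigenvectorUnitary : Matrix n n ℂ)ᴴ) * X *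
        ((hσ.eigenvectorUnitary : Matrix n n ℂ) * (hσ.eigenvectorUnitary : Matrix n n ℂ)ᴴ) := by
        simp only [eigenCoords, Matrix.mul_assoc]
    _ = X := by rw [h, Matrix.one_mul, Matrix.mul_one]

theorem eigenCoords_conj (X : Matrix n n ℂ) :
    eigenCoords hσ ((hσ.eigenvectorUnitary : Matrix n n ℂ) * X *
      (hσ.eigenvectorUnitary : Matrix n n ℂ)ᴴ) = X := by
  have h := eigenvectorUnitary_conjTranspose_mul hσ
  calc _ = ((hσ.eigenvectorUnitary : Matrix n n ℂ)ᴴ * (hσ.eigenvectorUnitary : Matrix n n ℂ)) * X *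
        ((hσ.eigenvectorUnitary : Matrix n n ℂ)ᴴ * (hσ.eigenvectorUnitary : Matrix n n ℂ)) := by
        simp only [eigenCoords, Matrix.mul_assoc]
    _ = X := by rw [h, Matrix.one_mul, Matrix.mul_one]

theorem eigenCoords_mul (X Y : Matrix n n ℂ) :
    eigenCoords hσ (X * Y) = eigenCoords hσ X * eigenCoords hσ Y := by
  have h := eigenvectorUnitary_mul_conjTranspose hσ
  calc _ = (hσ.eigenvectorUnitary : Matrix n n ℂ)ᴴ * X *
        ((hσ.eigenvectorUnitary : Matrix n n ℂ) * (hσ.eigenvectorUnitary : Matrix n n ℂ)ᴴ) * Y *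
        (hσ.eigenvectorUnitary : Matrix n n ℂ) := by
        rw [h, Matrix.mul_one]; simp only [eigenCoords, Matrix.mul_assoc]
    _ = _ := by simp only [eigenCoords, Matrix.mul_assoc]

theorem eigenCoords_sub (X Y : Matrix n n ℂ) :
    eigenCoords hσ (X - Y) = eigenCoords hσ X - eigenCoords hσ Y := by
  simp only [eigenCoords, Matrix.mul_sub, Matrix.sub_mul]

theorem trace_eigenCoords (X : Matrix n n ℂ) : (eigenCoords hσ X).trace = X.trace := by
  rw [eigenCoords, trace_mul_comm, ← Matrix.mul_assoc, eigenvectorUnitary_mul_conjTranspose,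
    Matrix.one_mul]

theorem isHermitian_eigenCoords {X : Matrix n n ℂ} (hX : X.IsHermitian) :
    (eigenCoords hσ X).IsHermitian :=
  isHermitian_conjTranspose_mul_mul _ hX

theorem eigenCoords_self :
    eigenCoords hσ σ = diagonal fun i => (hσ.eigenvalues i : ℂ) := by
  have h := hσ.spectral_theorem
  rw [Unitary.conjStarAlgAut_apply] at h
  exact (congrArg (eigenCoords hσ) h).trans (eigenCoords_conj hσ _)

theorem quadForm_eq_sum (u v : ℝ) (X Y : Matrix n n ℂ) :
    quadForm u v X σ Y = ∑ i, ∑ j,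
      (2 * (star (eigenCoords hσ Y i j) * eigenCoords hσ X i j).re -
        (u * hσ.eigenvalues i + v * hσ.eigenvalues j) *
          Complex.normSq (eigenCoords hσ Y i j)) := by
  have h := quadForm_conj (eigenvectorUnitary_conjTranspose_mul hσ) u v (eigenCoords hσ X)
    (eigenCoords hσ σ) (eigenCoords hσ Y)
  rw [conj_eigenCoords, conj_eigenCoords, conj_eigenCoords] at h
  rw [h, eigenCoords_self, quadForm_diagonal]

/-- The value `⟨X, (u L_σ + v R_σ)⁻¹ X⟩`, where the inverse vanishes on the kernel. -/
noncomputable def resolventForm (u v : ℝ) (X : Matrix n n ℂ) : ℝ :=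
  ∑ i, ∑ j, Complex.normSq (eigenCoords hσ X i j) /
    (u * hσ.eigenvalues i + v * hσ.eigenvalues j)

theorem exists_quadForm_eq_resolventForm (u v : ℝ) (X : Matrix n n ℂ) :
    ∃ Y, quadForm u v X σ Y = resolventForm hσ u v X := by
  -- The entrywise maximizer is `x / w`; where `w = 0`, both it and the resolvent term are zero by
  -- the convention for division.
  refine ⟨(hσ.eigenvectorUnitary : Matrix n n ℂ) *
    (of fun i j => eigenCoords hσ X i j /
      ((u * hσ.eigenvalues i + v * hσ.eigenvalues j : ℝ) : ℂ)) *
    (hσ.eigenvectorUnitary : Matrix n n ℂ)ᴴ, ?_⟩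
  rw [quadForm_eq_sum hσ, eigenCoords_conj, resolventForm]
  refine Finset.sum_congr rfl fun i _ => Finset.sum_congr rfl fun j _ => ?_
  simp only [of_apply]
  generalize u * hσ.eigenvalues i + v * hσ.eigenvalues j = w
  generalize eigenCoords hσ X i j = x
  have : (star (x / (w : ℂ)) * x).re = Complex.normSq x / w := by
    rw [star_div₀, div_mul_eq_mul_div, RCLike.star_def, Complex.conj_ofReal,
      ← Complex.normSq_eq_conj_mul_self, ← Complex.ofReal_div, Complex.ofReal_re]
  rw [this, Complex.normSq_div, Complex.normSq_ofReal]
  by_cases hw : w = 0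
  · simp [hw]
  · field_simp
    ring

/-- Complete the square entry by entry: `|w y - x|² ≥ 0`. A vanishing `w` forces a zero eigenvalue,
and there `hX` removes the linear term. -/
theorem quadForm_le_resolventForm (hpos : ∀ i, 0 ≤ hσ.eigenvalues i) {u v : ℝ} (hu : 0 ≤ u)
    (hv : 0 ≤ v) (huv : 0 < u + v) {X : Matrix n n ℂ}
    (hX : ∀ i j, hσ.eigenvalues i = 0 ∨ hσ.eigenvalues j = 0 → eigenCoords hσ X i j = 0)
    (Y : Matrix n n ℂ) : quadForm u v X σ Y ≤ resolventForm hσ u v X := by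
  rw [quadForm_eq_sum hσ, resolventForm]
  refine Finset.sum_le_sum fun i _ => Finset.sum_le_sum fun j _ => ?_
  have h0 := hX i j
  have hi := hpos i
  have hj := hpos j
  generalize eigenCoords hσ X i j = x at *
  generalize eigenCoords hσ Y i j = y
  generalize hσ.eigenvalues i = l at *
  generalize hσ.eigenvalues j = m at *
  have hw : 0 ≤ u * l + v * m := by positivity
  rcases hw.eq_or_lt with hw | hw
  · have : l = 0 ∨ m = 0 := by
      by_contra! hc
      have hl := lt_of_le_of_ne hi hc.1.symm
      have hm := lt_of_le_of_ne hj hc.2.symm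
      rcases hu.eq_or_lt with h | h
      · have : 0 < v := by linarith
        nlinarith [mul_pos this hm]
      · nlinarith [mul_pos h hl, mul_nonneg hv hj]
    simp [h0 this, ← hw]
  · generalize u * l + v * m = w at *
    rw [le_div_iff₀ hw]
    simp only [RCLike.star_def, Complex.mul_re, Complex.conj_re, Complex.conj_im,
      Complex.normSq_apply]
    nlinarith [sq_nonneg (w * y.re - x.re), sq_nonneg (w * y.im - x.im)]

end eigenCoords

/-! ### Supports and the trace in eigencoordinates. -/

section support

variable {d : ℕ} {ρ σ : Matrix (Fin d) (Fin d) ℂ}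

theorem matrixSupport_le_iff : matrixSupport ρ ≤ matrixSupport σ ↔ ∃ W, ρ = σ * W := by
  constructor
  · intro h
    have (j : Fin d) : ∃ w, σ *ᵥ w = ρ *ᵥ Pi.single j 1 := h ⟨Pi.single j 1, rfl⟩
    choose w hw using this
    refine ⟨of fun i j => w j i, ?_⟩
    ext i j
    have := congrFun (hw j) i
    rw [mulVec_single_one] at this
    exact this.symm
  · rintro ⟨W, rfl⟩ _ ⟨x, rfl⟩
    exact ⟨W *ᵥ x, by simp⟩

theorem eigenCoords_sub_eq_zero (hσ : σ.IsHermitian) (hρ : ρ.IsHermitian)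
    (h : matrixSupport ρ ≤ matrixSupport σ) (i j : Fin d)
    (hij : hσ.eigenvalues i = 0 ∨ hσ.eigenvalues j = 0) :
    eigenCoords hσ (ρ - σ) i j = 0 := by
  have key (i j : Fin d) (hi : hσ.eigenvalues i = 0) : eigenCoords hσ (ρ - σ) i j = 0 := by
    obtain ⟨W, rfl⟩ := matrixSupport_le_iff.1 h
    rw [show σ * W - σ = σ * (W - 1) by rw [Matrix.mul_sub, Matrix.mul_one], eigenCoords_mul,
      eigenCoords_self, diagonal_mul, hi]
    simp
  rcases hij with hi | hj
  · exact key i j hi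
  · rw [← (isHermitian_eigenCoords hσ (hρ.sub hσ)).apply i j, key j i hj, star_zero]

-- On a kernel direction `i` of `σ`, the test matrix `c • e_i e_iᴴ` kills the quadratic terms and
-- leaves `2 * c * ρ i i`. Boundedness in `c` forces `ρ i i = 0`, and positivity of `ρ` then kills
-- the whole row.
open scoped ComplexOrder in
theorem matrixSupport_le_of_quadForm_le (hσ : σ.IsHermitian) (hρ : ρ.PosSemidef) {u v M : ℝ}
    (h : ∀ Y, quadForm u v (ρ - σ) σ Y ≤ M) : matrixSupport ρ ≤ matrixSupport σ := by
  have hρ' : (eigenCoords hσ ρ).PosSemidef := hρ.conjTranspose_mul_mul_same _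
  have hz (i j : Fin d) (hi : hσ.eigenvalues i = 0) : eigenCoords hσ ρ i j = 0 := by
    have hre : (eigenCoords hσ ρ i i).re = 0 := by
      have hb (c : ℝ) : 2 * (c * (eigenCoords hσ ρ i i).re) ≤ M := by
        have hq := h ((hσ.eigenvectorUnitary : Matrix (Fin d) (Fin d) ℂ) *
          Matrix.single i i (c : ℂ) * (hσ.eigenvectorUnitary : Matrix (Fin d) (Fin d) ℂ)ᴴ)
        rw [quadForm_eq_sum hσ, eigenCoords_conj, Finset.sum_eq_single i, Finset.sum_eq_single i]
          at hq
        · simpa [hi, eigenCoords_sub, eigenCoords_self] using hq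
        · intro k _ hk
          simp [hk.symm]
        · simp
        · intro k _ hk
          simp [hk.symm]
        · simp
      by_contra hne
      have := hb ((M + 1) / (eigenCoords hσ ρ i i).re)
      rw [div_mul_cancel₀ _ hne] at this
      have h0 := hb 0
      simp at h0
      linarith
    have hdiag : eigenCoords hσ ρ i i = 0 := by
      have := Complex.nonneg_iff.1 (hρ'.diag_nonneg (i := i))
      exact Complex.ext hre this.2.symm
    have hv := (hρ'.dotProduct_mulVec_zero_iff (Pi.single i 1)).1 (by
      rw [mulVec_single_one]
      simp [hdiag])
    rw [mulVec_single_one] at hv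
    rw [← hρ'.1.apply i j]
    have := congrFun hv j
    simp at this
    simp [this]
  -- The witness is the pseudo-inverse of `σ` times `ρ`.
  refine matrixSupport_le_iff.2 ⟨(hσ.eigenvectorUnitary : Matrix (Fin d) (Fin d) ℂ) *
    ((diagonal fun i => ((hσ.eigenvalues i)⁻¹ : ℂ)) * eigenCoords hσ ρ) *
    (hσ.eigenvectorUnitary : Matrix (Fin d) (Fin d) ℂ)ᴴ, ?_⟩
  rw [← conj_eigenCoords hσ (σ * _), eigenCoords_mul, eigenCoords_conj, eigenCoords_self]
  conv_lhs => rw [← conj_eigenCoords hσ ρ]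
  congr 2
  ext i j
  rw [diagonal_mul, diagonal_mul]
  by_cases hi : hσ.eigenvalues i = 0
  · simp [hz i j hi]
  · have : (hσ.eigenvalues i : ℂ) ≠ 0 := by exact_mod_cast hi
    field_simp

open scoped MatrixOrder ComplexOrder in
theorem eigenCoords_rpow (hσ : σ.PosSemidef) (s : ℝ) :
    eigenCoords hσ.1 (CFC.rpow σ s) = diagonal fun i => ((hσ.1.eigenvalues i ^ s : ℝ) : ℂ) := by
  have h : CFC.rpow σ s = hσ.1.cfc (fun x => x ^ s) := by
    rw [← hσ.1.cfc_eq]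
    exact CFC.rpow_eq_cfc_real hσ.nonneg
  rw [h, IsHermitian.cfc, Unitary.conjStarAlgAut_apply]
  exact eigenCoords_conj hσ.1 _

open scoped MatrixOrder ComplexOrder in
theorem chiSqTrace_re_eq_sum (α : ℝ) (hσ : σ.PosSemidef) (hρ : ρ.IsHermitian) :
    (chiSqTrace α ρ σ).re = ∑ i, ∑ j, Complex.normSq (eigenCoords hσ.1 (ρ - σ) i j) *
      (hσ.1.eigenvalues i ^ (-α) * hσ.1.eigenvalues j ^ (α - 1)) := by
  have hX := isHermitian_eigenCoords hσ.1 (hρ.sub hσ.1)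
  rw [chiSqTrace, ← trace_eigenCoords hσ.1]
  simp only [eigenCoords_mul, eigenCoords_rpow hσ]
  rw [Finset.sum_comm]
  simp only [trace, diag_apply, mul_diagonal, mul_apply (N := eigenCoords _ _), Finset.sum_mul,
    Complex.re_sum]
  refine Finset.sum_congr rfl fun i _ => Finset.sum_congr rfl fun j _ => ?_
  rw [← hX.apply i j]
  generalize eigenCoords hσ.1 (ρ - σ) j i = x
  generalize hσ.1.eigenvalues j ^ (-α) = p
  generalize hσ.1.eigenvalues i ^ (α - 1) = q
  simp [Complex.normSq_apply]
  ring

end support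

end VariationalForm

/-! ### Integral representation of the weights. -/

theorem rpowIntegrand_mul_inv_eq {α l m t : ℝ} (hl : 0 < l) (hm : 0 < m) (ht : 0 < t) :
    Real.rpowIntegrand₀₁ (1 - α) t (l / m) * l⁻¹ = t ^ (-α) / (l + t * m) := by
  rw [Real.rpowIntegrand₀₁, show t ^ (1 - α) = t ^ (-α) * t by
    rw [← Real.rpow_add_one ht.ne']; ring_nf]
  have : t * m + l ≠ 0 := by positivity
  have : l + t * m ≠ 0 := by positivity
  have : t + l / m ≠ 0 := by positivity
  field_simp
  ring

/-- The normalizing constant of the integral representation of `l ^ (-α) * m ^ (α - 1)`. -/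
noncomputable def resolventConst (α : ℝ) : ℝ :=
  (∫ t in Ioi 0, Real.rpowIntegrand₀₁ (1 - α) t 1)⁻¹

theorem resolventConst_nonneg {α : ℝ} (hα : α ∈ Ioo (0 : ℝ) 1) : 0 ≤ resolventConst α :=
  inv_nonneg.2 (Real.integral_rpowIntegrand₀₁_one_pos
    ⟨by linarith [hα.2], by linarith [hα.1]⟩).le

theorem integrableOn_rpow_div {α l m : ℝ} (hα : α ∈ Ioo (0 : ℝ) 1) (hl : 0 < l) (hm : 0 < m) :
    IntegrableOn (fun t => t ^ (-α) / (l + t * m)) (Ioi 0) := by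
  refine IntegrableOn.congr_fun ((Real.integrableOn_rpowIntegrand₀₁_Ioi (p := 1 - α)
    ⟨by linarith [hα.2], by linarith [hα.1]⟩ (div_pos hl hm).le).mul_const l⁻¹)
    (fun t ht => rpowIntegrand_mul_inv_eq hl hm ht) measurableSet_Ioi

/-- The integral formula for `x ^ (1 - α)` at `x = l / m`, divided by `l`. -/
theorem rpow_mul_rpow_eq_integral {α l m : ℝ} (hα : α ∈ Ioo (0 : ℝ) 1) (hl : 0 < l)
    (hm : 0 < m) :
    l ^ (-α) * m ^ (α - 1) = resolventConst α * ∫ t in Ioi 0, t ^ (-α) / (l + t * m) := by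
  rw [← setIntegral_congr_fun measurableSet_Ioi
    (fun t ht => rpowIntegrand_mul_inv_eq hl hm ht), integral_mul_const, resolventConst,
    ← mul_assoc, ← Real.rpow_eq_const_mul_integral ⟨by linarith [hα.2], by linarith [hα.1]⟩
    (div_pos hl hm).le, Real.div_rpow hl.le hm.le, show -α = (1 - α) - 1 by ring,
    Real.rpow_sub_one hl.ne', show α - 1 = -(1 - α) by ring, Real.rpow_neg hm.le]
  ring

/-! ### Channels and the Schwarz inequality for the adjoint. -/

section QuantumChannel

variable {d : ℕ} {T : Matrix (Fin d) (Fin d) ℂ →ₗ[ℂ] Matrix (Fin d) (Fin d) ℂ}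

theorem CStarAlgebra.exists_eq_star_mul_self {A : Type*} [NonUnitalCStarAlgebra A] [PartialOrder A]
    [StarOrderedRing A] {a : A} (ha : 0 ≤ a) : ∃ s, a = star s * s :=
  CStarAlgebra.nonneg_iff_eq_star_mul_self.1 ha

-- This is 2-positivity, all that is used of complete positivity: the image of `star N * N` under
-- the entrywise map is again of the form `star S * S`.
open scoped MatrixOrder Matrix.Norms.L2Operator CStarAlgebra in
theorem IsQuantumChannel.exists_block (hT : IsQuantumChannel T)
    (B C : Matrix (Fin d) (Fin d) ℂ) :
    ∃ S : Fin 2 → Fin 2 → Matrix (Fin d) (Fin d) ℂ,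
      T (Bᴴ * B) = (S 0 0)ᴴ * S 0 0 + (S 1 0)ᴴ * S 1 0 ∧
      T (Bᴴ * C) = (S 0 0)ᴴ * S 0 1 + (S 1 0)ᴴ * S 1 1 ∧
      T (Cᴴ * B) = (S 0 1)ᴴ * S 0 0 + (S 1 1)ᴴ * S 1 0 ∧
      T (Cᴴ * C) = (S 0 1)ᴴ * S 0 1 + (S 1 1)ᴴ * S 1 1 := by
  obtain ⟨⟨Φ, hΦ⟩, -⟩ := hT
  let N : CStarMatrix (Fin 2) (Fin 2) (Matrix (Fin d) (Fin d) ℂ) :=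
    CStarMatrix.ofMatrix !![B, C; 0, 0]
  have h := Φ.map_cstarMatrix_nonneg (star N * N) (star_mul_self_nonneg N)
  obtain ⟨S, hS⟩ := CStarAlgebra.exists_eq_star_mul_self h
  have e (i j : Fin 2) : T (∑ k, (N k i)ᴴ * N k j) = ∑ k, (S k i)ᴴ * S k j := by
    rw [← hΦ]
    exact congrFun (congrFun hS i) j
  refine ⟨fun i j => S i j, ?_, ?_, ?_, ?_⟩
  · simpa [N, Fin.sum_univ_two, -map_add] using e 0 0
  · simpa [N, Fin.sum_univ_two, -map_add] using e 0 1
  · simpa [N, Fin.sum_univ_two, -map_add] using e 1 0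
  · simpa [N, Fin.sum_univ_two, -map_add] using e 1 1

theorem IsQuantumChannel.map_conjTranspose (hT : IsQuantumChannel T)
    (A : Matrix (Fin d) (Fin d) ℂ) : T Aᴴ = (T A)ᴴ := by
  obtain ⟨S, -, h₁, h₂, -⟩ := hT.exists_block 1 A
  rw [conjTranspose_one, Matrix.one_mul] at h₁
  rw [Matrix.mul_one] at h₂
  simp [h₁, h₂]

open scoped ComplexOrder MatrixOrder in
theorem IsQuantumChannel.map_posSemidef (hT : IsQuantumChannel T)
    {A : Matrix (Fin d) (Fin d) ℂ} (hA : A.PosSemidef) : (T A).PosSemidef := by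
  obtain ⟨B, rfl⟩ := CStarAlgebra.nonneg_iff_eq_star_mul_self.1 hA.nonneg
  obtain ⟨S, h, -⟩ := hT.exists_block B 0
  rw [star_eq_conjTranspose, h]
  exact (posSemidef_conjTranspose_mul_self _).add (posSemidef_conjTranspose_mul_self _)

/-- The adjoint of a linear map of matrices with respect to the bilinear form `tr (A * B)`. -/
noncomputable def traceAdjoint (T : Matrix (Fin d) (Fin d) ℂ →ₗ[ℂ] Matrix (Fin d) (Fin d) ℂ)
    (Y : Matrix (Fin d) (Fin d) ℂ) : Matrix (Fin d) (Fin d) ℂ :=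
  of fun i j => (Y * T (Matrix.single j i 1)).trace

theorem trace_traceAdjoint_mul (Y A : Matrix (Fin d) (Fin d) ℂ) :
    (traceAdjoint T Y * A).trace = (Y * T A).trace := by
  conv_rhs => rw [matrix_eq_sum_single A]
  have h (i j : Fin d) : Matrix.single i j (A i j) = A i j • Matrix.single i j (1 : ℂ) := by simp
  simp only [h, map_sum, map_smul, Finset.mul_sum, trace_sum, Matrix.mul_smul, trace_smul]
  rw [Finset.sum_comm]
  simp [trace, mul_apply (N := A), traceAdjoint, mul_comm]

theorem IsQuantumChannel.traceAdjoint_conjTranspose (hT : IsQuantumChannel T)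
    (Y : Matrix (Fin d) (Fin d) ℂ) : traceAdjoint T Yᴴ = (traceAdjoint T Y)ᴴ := by
  ext i j
  simp only [traceAdjoint, of_apply, conjTranspose_apply]
  rw [← trace_conjTranspose, conjTranspose_mul, ← hT.map_conjTranspose, conjTranspose_single,
    star_one, trace_mul_comm]

-- Write `σ = Bᴴ * B`. The blocks of `T` at `B` and `B * Z`, tested on the column `(Y, -1)`, have
-- nonnegative trace. Both cross terms equal `tr (σ Z Zᴴ)` by duality, as does the last term by
-- trace preservation, so one copy is left with a minus sign.
open scoped ComplexOrder MatrixOrder in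
theorem IsQuantumChannel.trace_adjoint_schwarz (hT : IsQuantumChannel T)
    {σ : Matrix (Fin d) (Fin d) ℂ} (hσ : σ.PosSemidef) (Y : Matrix (Fin d) (Fin d) ℂ) :
    (σ * traceAdjoint T Y * (traceAdjoint T Y)ᴴ).trace.re ≤ (T σ * Y * Yᴴ).trace.re := by
  set Z := traceAdjoint T Y with hZ
  obtain ⟨B, rfl⟩ := CStarAlgebra.nonneg_iff_eq_star_mul_self.1 hσ.nonneg
  rw [star_eq_conjTranspose]
  obtain ⟨S, h₀₀, h₀₁, h₁₀, h₁₁⟩ := hT.exists_block B (B * Z)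
  have hpos : 0 ≤ ((S 0 0 * Y - S 0 1)ᴴ * (S 0 0 * Y - S 0 1) +
      (S 1 0 * Y - S 1 1)ᴴ * (S 1 0 * Y - S 1 1)).trace.re :=
    (Complex.nonneg_iff.1 (((posSemidef_conjTranspose_mul_self _).add
      (posSemidef_conjTranspose_mul_self _)).trace_nonneg)).1
  have hexp : (S 0 0 * Y - S 0 1)ᴴ * (S 0 0 * Y - S 0 1) +
      (S 1 0 * Y - S 1 1)ᴴ * (S 1 0 * Y - S 1 1) =
      Yᴴ * T (Bᴴ * B) * Y - Yᴴ * T (Bᴴ * (B * Z)) - T ((B * Z)ᴴ * B) * Y +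
        T ((B * Z)ᴴ * (B * Z)) := by
    rw [h₀₀, h₀₁, h₁₀, h₁₁]
    simp only [conjTranspose_sub, conjTranspose_mul]
    noncomm_ring
  rw [hexp] at hpos
  have e₁ : (Yᴴ * T (Bᴴ * B) * Y).trace = (T (Bᴴ * B) * Y * Yᴴ).trace := by
    rw [Matrix.mul_assoc, trace_mul_comm]
  have e₂ : (Yᴴ * T (Bᴴ * (B * Z))).trace = (Bᴴ * B * Z * Zᴴ).trace := by
    rw [← trace_traceAdjoint_mul, hT.traceAdjoint_conjTranspose, trace_mul_comm, ← hZ]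
    simp only [Matrix.mul_assoc]
  have e₃ : (T ((B * Z)ᴴ * B) * Y).trace = (Bᴴ * B * Z * Zᴴ).trace := by
    rw [trace_mul_comm, ← trace_traceAdjoint_mul, trace_mul_comm, ← hZ,
      trace_mul_comm (Bᴴ * B * Z)]
    simp only [Matrix.mul_assoc, conjTranspose_mul]
  have e₄ : (T ((B * Z)ᴴ * (B * Z))).trace = (Bᴴ * B * Z * Zᴴ).trace := by
    rw [hT.2, trace_mul_comm (Bᴴ * B * Z)]
    simp only [Matrix.mul_assoc, conjTranspose_mul]
  simp only [trace_add, trace_sub, e₁, e₂, e₃, e₄, Complex.add_re, Complex.sub_re] at hpos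
  linarith

end QuantumChannel

open scoped ComplexOrder

/-! ### From resolvent bounds to the divergence. -/

section resolventForm

variable {d : ℕ} {ρ σ : Matrix (Fin d) (Fin d) ℂ} {α : ℝ}

theorem rpow_neg_mul_resolventForm (hσ : σ.IsHermitian) (X : Matrix (Fin d) (Fin d) ℂ) (t : ℝ) :
    t ^ (-α) * resolventForm hσ 1 t X =
      ∑ i, ∑ j, Complex.normSq (eigenCoords hσ X i j) *
        (t ^ (-α) / (hσ.eigenvalues i + t * hσ.eigenvalues j)) := by
  simp only [resolventForm, Finset.mul_sum, one_mul]
  refine Finset.sum_congr rfl fun i _ => Finset.sum_congr rfl fun j _ => ?_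
  ring

/-- The kernel is not integrable when exactly one eigenvalue vanishes, but the support condition
makes the coefficient zero there. -/
theorem integrableOn_normSq_eigenCoords_mul (hα : α ∈ Ioo (0 : ℝ) 1) (hσ : σ.PosSemidef)
    (hρ : ρ.IsHermitian) (h : matrixSupport ρ ≤ matrixSupport σ) (i j : Fin d) :
    IntegrableOn (fun t => Complex.normSq (eigenCoords hσ.1 (ρ - σ) i j) *
      (t ^ (-α) / (hσ.1.eigenvalues i + t * hσ.1.eigenvalues j))) (Ioi 0) := by
  by_cases hij : hσ.1.eigenvalues i = 0 ∨ hσ.1.eigenvalues j = 0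
  · simp [eigenCoords_sub_eq_zero hσ.1 hρ h i j hij]
  · rw [not_or] at hij
    exact (integrableOn_rpow_div hα ((hσ.eigenvalues_nonneg i).lt_of_ne' hij.1)
      ((hσ.eigenvalues_nonneg j).lt_of_ne' hij.2)).const_mul _

theorem integrableOn_resolventForm (hα : α ∈ Ioo (0 : ℝ) 1) (hσ : σ.PosSemidef)
    (hρ : ρ.IsHermitian) (h : matrixSupport ρ ≤ matrixSupport σ) :
    IntegrableOn (fun t => t ^ (-α) * resolventForm hσ.1 1 t (ρ - σ)) (Ioi 0) := by
  simp only [rpow_neg_mul_resolventForm]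
  exact integrable_finsetSum _ fun i _ => integrable_finsetSum _ fun j _ =>
    integrableOn_normSq_eigenCoords_mul hα hσ hρ h i j

theorem chiSqTrace_re_eq_integral (hα : α ∈ Ioo (0 : ℝ) 1) (hσ : σ.PosSemidef)
    (hρ : ρ.IsHermitian) (h : matrixSupport ρ ≤ matrixSupport σ) :
    (chiSqTrace α ρ σ).re = resolventConst α *
      ∫ t in Ioi 0, t ^ (-α) * resolventForm hσ.1 1 t (ρ - σ) := by
  simp only [rpow_neg_mul_resolventForm]
  have hint := integrableOn_normSq_eigenCoords_mul hα hσ hρ h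
  rw [chiSqTrace_re_eq_sum α hσ hρ, integral_finsetSum _ fun i _ =>
    integrable_finsetSum _ fun j _ => hint i j, Finset.mul_sum]
  refine Finset.sum_congr rfl fun i _ => ?_
  rw [integral_finsetSum _ fun j _ => hint i j, Finset.mul_sum]
  refine Finset.sum_congr rfl fun j _ => ?_
  by_cases hij : hσ.1.eigenvalues i = 0 ∨ hσ.1.eigenvalues j = 0
  · simp [eigenCoords_sub_eq_zero hσ.1 hρ h i j hij]
  · rw [not_or] at hij
    rw [rpow_mul_rpow_eq_integral hα ((hσ.eigenvalues_nonneg i).lt_of_ne' hij.1)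
      ((hσ.eigenvalues_nonneg j).lt_of_ne' hij.2), integral_const_mul]
    ring

theorem chiSqTrace_zero_re (hσ : σ.PosSemidef) (hρ : ρ.IsHermitian) :
    (chiSqTrace 0 ρ σ).re = resolventForm hσ.1 0 1 (ρ - σ) := by
  simp [chiSqTrace_re_eq_sum 0 hσ hρ, resolventForm, Real.rpow_neg_one, div_eq_mul_inv]

theorem chiSqTrace_one_re (hσ : σ.PosSemidef) (hρ : ρ.IsHermitian) :
    (chiSqTrace 1 ρ σ).re = resolventForm hσ.1 1 0 (ρ - σ) := by
  simp [chiSqTrace_re_eq_sum 1 hσ hρ, resolventForm, Real.rpow_neg_one, div_eq_mul_inv]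

theorem quadForm_sub_le_resolventForm (hσ : σ.PosSemidef) (hρ : ρ.IsHermitian)
    (h : matrixSupport ρ ≤ matrixSupport σ) {u v : ℝ} (hu : 0 ≤ u) (hv : 0 ≤ v) (huv : 0 < u + v)
    (Y : Matrix (Fin d) (Fin d) ℂ) :
    quadForm u v (ρ - σ) σ Y ≤ resolventForm hσ.1 u v (ρ - σ) :=
  quadForm_le_resolventForm hσ.1 hσ.eigenvalues_nonneg hu hv huv
    (eigenCoords_sub_eq_zero hσ.1 hρ h) Y

/-- A bound on the variational functions of `ρ - σ` that is uniform in `Y` gives both the support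
condition and the corresponding bound on the divergence. -/
theorem chiSq_le_of_quadForm_le {ρ₁ σ₁ ρ₂ σ₂ : Matrix (Fin d) (Fin d) ℂ}
    (hα : α ∈ Icc (0 : ℝ) 1) (hρ : ρ.PosSemidef) (hσ : σ.PosSemidef)
    (hρ₁ : ρ₁.IsHermitian) (hσ₁ : σ₁.PosSemidef) (h₁ : matrixSupport ρ₁ ≤ matrixSupport σ₁)
    (hρ₂ : ρ₂.IsHermitian) (hσ₂ : σ₂.PosSemidef) (h₂ : matrixSupport ρ₂ ≤ matrixSupport σ₂)
    {a b : ℝ}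
    (hle : ∀ u v : ℝ, 0 ≤ u → 0 ≤ v → 0 < u + v → ∀ Y, quadForm u v (ρ - σ) σ Y ≤
      a * resolventForm hσ₁.1 u v (ρ₁ - σ₁) + b * resolventForm hσ₂.1 u v (ρ₂ - σ₂)) :
    chiSq α ρ σ ≤
      ((a * (chiSqTrace α ρ₁ σ₁).re + b * (chiSqTrace α ρ₂ σ₂).re : ℝ) : EReal) := by
  have h : matrixSupport ρ ≤ matrixSupport σ :=
    matrixSupport_le_of_quadForm_le hσ.1 hρ (hle 1 0 zero_le_one le_rfl (by norm_num))
  have hle' (u v : ℝ) (hu : 0 ≤ u) (hv : 0 ≤ v) (huv : 0 < u + v) :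
      resolventForm hσ.1 u v (ρ - σ) ≤
        a * resolventForm hσ₁.1 u v (ρ₁ - σ₁) + b * resolventForm hσ₂.1 u v (ρ₂ - σ₂) := by
    obtain ⟨Y, hY⟩ := exists_quadForm_eq_resolventForm hσ.1 u v (ρ - σ)
    exact hY.ge.trans (hle u v hu hv huv Y)
  rw [chiSq, if_pos h, EReal.coe_le_coe_iff]
  -- The endpoints fall outside the integral representation; each is a single resolvent form.
  rcases hα.1.eq_or_lt with rfl | h0
  · rw [chiSqTrace_zero_re hσ hρ.1, chiSqTrace_zero_re hσ₁ hρ₁, chiSqTrace_zero_re hσ₂ hρ₂]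
    exact hle' 0 1 le_rfl zero_le_one (by norm_num)
  rcases hα.2.eq_or_lt with rfl | h1
  · rw [chiSqTrace_one_re hσ hρ.1, chiSqTrace_one_re hσ₁ hρ₁, chiSqTrace_one_re hσ₂ hρ₂]
    exact hle' 1 0 zero_le_one le_rfl (by norm_num)
  have hα' : α ∈ Ioo (0 : ℝ) 1 := ⟨h0, h1⟩
  have i₁ := (integrableOn_resolventForm hα' hσ₁ hρ₁ h₁).const_mul a
  have i₂ := (integrableOn_resolventForm hα' hσ₂ hρ₂ h₂).const_mul b
  rw [chiSqTrace_re_eq_integral hα' hσ hρ.1 h, chiSqTrace_re_eq_integral hα' hσ₁ hρ₁ h₁,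
    chiSqTrace_re_eq_integral hα' hσ₂ hρ₂ h₂, mul_left_comm a, mul_left_comm b, ← mul_add]
  refine mul_le_mul_of_nonneg_left ?_ (resolventConst_nonneg hα')
  rw [← integral_const_mul, ← integral_const_mul, ← integral_add i₁ i₂]
  refine setIntegral_mono_on (integrableOn_resolventForm hα' hσ hρ.1 h) (i₁.add i₂)
    measurableSet_Ioi fun t ht => ?_
  have ht' : (0 : ℝ) < t := ht
  have := mul_le_mul_of_nonneg_left (hle' 1 t zero_le_one ht'.le (by linarith))
    (Real.rpow_nonneg ht'.le (-α))
  linarith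

end resolventForm

/-! ### Joint convexity and monotonicity. -/

theorem chiSq_jointly_convex {d : ℕ} {α : ℝ} (hα : α ∈ Icc (0 : ℝ) 1)
    {ρ₁ σ₁ ρ₂ σ₂ : Matrix (Fin d) (Fin d) ℂ} (hρ₁ : ρ₁.PosSemidef) (hσ₁ : σ₁.PosSemidef)
    (hρ₂ : ρ₂.PosSemidef) (hσ₂ : σ₂.PosSemidef) {a b : ℝ} (ha : 0 < a) (hb : 0 < b) :
    chiSq α (a • ρ₁ + b • ρ₂) (a • σ₁ + b • σ₂) ≤
      (a : EReal) * chiSq α ρ₁ σ₁ + (b : EReal) * chiSq α ρ₂ σ₂ := by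
  -- If either support condition fails, the right side is `⊤`, because both weights are strictly
  -- positive.
  by_cases h₁ : matrixSupport ρ₁ ≤ matrixSupport σ₁
  swap
  · rw [chiSq, chiSq, if_neg h₁, EReal.coe_mul_top_of_pos ha, EReal.top_add_of_ne_bot]
    · exact le_top
    · rw [chiSq]
      split_ifs
      · rw [← EReal.coe_mul]
        exact EReal.coe_ne_bot _
      · simp [EReal.coe_mul_top_of_pos hb]
  by_cases h₂ : matrixSupport ρ₂ ≤ matrixSupport σ₂
  swap
  · rw [chiSq, chiSq, chiSq, if_neg h₂, EReal.coe_mul_top_of_pos hb, if_pos h₁, ← EReal.coe_mul,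
      EReal.coe_add_top]
    exact le_top
  rw [chiSq, chiSq, chiSq, if_pos h₁, if_pos h₂, ← EReal.coe_mul, ← EReal.coe_mul,
    ← EReal.coe_add, ← chiSq]
  refine chiSq_le_of_quadForm_le hα ((hρ₁.smul ha.le).add (hρ₂.smul hb.le))
    ((hσ₁.smul ha.le).add (hσ₂.smul hb.le)) hρ₁.1 hσ₁ h₁ hρ₂.1 hσ₂ h₂ fun u v hu hv huv Y => ?_
  rw [show a • ρ₁ + b • ρ₂ - (a • σ₁ + b • σ₂) = a • (ρ₁ - σ₁) + b • (ρ₂ - σ₂) by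
    rw [smul_sub, smul_sub]; abel, quadForm_smul_add]
  gcongr
  · exact quadForm_sub_le_resolventForm hσ₁ hρ₁.1 h₁ hu hv huv Y
  · exact quadForm_sub_le_resolventForm hσ₂ hρ₂.1 h₂ hu hv huv Y

/-- The linear term transfers exactly by duality; the Schwarz inequality at `Y` handles the `u` term
and at `Yᴴ` the `v` term. -/
theorem IsQuantumChannel.quadForm_le {d : ℕ}
    {T : Matrix (Fin d) (Fin d) ℂ →ₗ[ℂ] Matrix (Fin d) (Fin d) ℂ} (hT : IsQuantumChannel T)
    {σ : Matrix (Fin d) (Fin d) ℂ} (hσ : σ.PosSemidef) {u v : ℝ} (hu : 0 ≤ u) (hv : 0 ≤ v)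
    (X Y : Matrix (Fin d) (Fin d) ℂ) :
    quadForm u v (T X) (T σ) Y ≤ quadForm u v X σ (traceAdjoint T Y) := by
  have h₁ := mul_le_mul_of_nonneg_left (hT.trace_adjoint_schwarz hσ Y) hu
  have h₂ := mul_le_mul_of_nonneg_left (hT.trace_adjoint_schwarz hσ Yᴴ) hv
  rw [hT.traceAdjoint_conjTranspose, conjTranspose_conjTranspose,
    conjTranspose_conjTranspose] at h₂
  rw [quadForm, quadForm, ← hT.traceAdjoint_conjTranspose, trace_traceAdjoint_mul,
    hT.traceAdjoint_conjTranspose]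
  linarith

theorem chiSq_map_le {d : ℕ} {α : ℝ} (hα : α ∈ Icc (0 : ℝ) 1)
    {T : Matrix (Fin d) (Fin d) ℂ →ₗ[ℂ] Matrix (Fin d) (Fin d) ℂ} (hT : IsQuantumChannel T)
    {ρ σ : Matrix (Fin d) (Fin d) ℂ} (hρ : ρ.PosSemidef) (hσ : σ.PosSemidef) :
    chiSq α (T ρ) (T σ) ≤ chiSq α ρ σ := by
  by_cases h : matrixSupport ρ ≤ matrixSupport σ
  swap
  · rw [chiSq, chiSq, if_neg h]
    exact le_top
  -- Only one comparison pair is needed, so the second gets weight `0`.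
  have key := chiSq_le_of_quadForm_le hα (hT.map_posSemidef hρ) (hT.map_posSemidef hσ)
    hρ.1 hσ h hρ.1 hσ h (a := 1) (b := 0) fun u v hu hv huv Y => by
      rw [← map_sub, one_mul, zero_mul, add_zero]
      exact (hT.quadForm_le hσ hu hv _ Y).trans
        (quadForm_sub_le_resolventForm hσ hρ.1 h hu hv huv _)
  rw [one_mul, zero_mul, add_zero] at key
  rwa [chiSq.eq_def α ρ σ, if_pos h]

theorem proposition7 (d : ℕ) (α : ℝ) (hα : α ∈ Set.Icc (0 : ℝ) 1) :
    (∀ ρ₁ ∈ densityMatrices d, ∀ σ₁ ∈ densityMatrices d,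
      ∀ ρ₂ ∈ densityMatrices d, ∀ σ₂ ∈ densityMatrices d,
      ∀ a b : ℝ, 0 ≤ a → 0 ≤ b → a + b = 1 →
        chiSq α (a • ρ₁ + b • ρ₂) (a • σ₁ + b • σ₂) ≤
          (a : EReal) * chiSq α ρ₁ σ₁ + (b : EReal) * chiSq α ρ₂ σ₂) ∧
    (∀ T : Matrix (Fin d) (Fin d) ℂ →ₗ[ℂ] Matrix (Fin d) (Fin d) ℂ, IsQuantumChannel T →
      ∀ ρ ∈ densityMatrices d, ∀ σ ∈ densityMatrices d,
        chiSq α (T ρ) (T σ) ≤ chiSq α ρ σ) := by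
  refine ⟨fun ρ₁ hρ₁ σ₁ hσ₁ ρ₂ hρ₂ σ₂ hσ₂ a b ha hb hab => ?_,
    fun T hT ρ hρ σ hσ => chiSq_map_le hα hT hρ.1 hσ.1⟩
  rcases ha.eq_or_lt with rfl | ha
  · obtain rfl : b = 1 := by linarith
    simp
  rcases hb.eq_or_lt with rfl | hb
  · obtain rfl : a = 1 := by linarith
    simp
  exact chiSq_jointly_convex hα hρ₁.1 hσ₁.1 hρ₂.1 hσ₂.1 ha hb
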